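/- **Model.** Let $V$ be a finite set of nodes, $E\subseteq V\times V$ a finite set of directed links $(v,u)$, $v\ne u$, let $O_v=\{u:(v,u)\in E\}$, and let $\mathcal C$ be a finite catalog. Node $v$ has cache capacity $c_v\in\mathbb N$ and power budget $\hat s_v\in\mathbb R$; item $i$ has a set $\mathcal S_i\subseteq V$ of designated sources. $\mathcal R$ is a finite set of requests $(i,p)$ with rates $\lambda_{(i,p)}>0$, where $p=(p_1,\dots,p_{|p|})$ is a simple path with $(p_k,p_{k+1})\in E$, $(p_{k+1},p_k)\in E$ and $p_{|p|}\in\mathcal S_i$. For powers $S=[s_{vu}]_{(v,u)\in E}$ (with $s_{vu}=0$ for $(v,u)\notin E$) put $$\mathrm{SINR}_{vu}(S)=\frac{G_{vu}s_{vu}}{N_u+\sum_{j\ne v}G_{ju}\sum_w s_{jw}+G_{vu}\sum_{w\neq u}s_{vw}},$$ where $N_u>0$, $G_{vu}=r_{vu}^{-n}$ for $v\ne u$ with distances $r_{vu}>0$ and $n>2$, and $G_{uu}\ge 0$ is an arbitrary self-interference gain. The delay $f_{p,k}(S)$ of the hop from $p_{k+1}$ to $p_k$ is $1/\log_2(1+\mathrm{SINR}_{p_{k+1}p_k}(S))\in(0,\infty]$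 (so $\infty$ at zero power), except that it is a fixed constant $D_{MC}\ge0$ or $D_{SC}\ge0$ on the last hop $k=|p|-1$ if $p_{|p|}$ is a wired MC or SC backhaul node. For $Y=[y_{vi}]\in\mathbb R^{V\times\mathcal C}$ let $$D(Y,S)=\sum_{(i,p)\in\mathcal R}\lambda_{(i,p)}\sum_{k=1}^{|p|-1}f_{p,k}(S)\Bigl(1-\min\Bigl\{1,\sum_{l=1}^k y_{p_l i}\Bigr\}\Bigr),\qquad \infty\cdot 0=0.$$ The feasible sets are $$\mathcal D_Y=\Bigl\{Y:\ \sum_{i}y_{vi}=c_v,\ y_{vi}\in[0,1],\ y_{vi}=1\text{ if }v\in\mathcal S_i\Bigr\},\qquad \mathcal D_S=\Bigl\{S:\ \sum_{u\in O_v}s_{vu}\le\hat s_v,\ s_{vu}\ge 0\Bigr\},$$ and the reduced-complexity formulation (RCF) is $\min\{D(Y,S):Y\in\mathcal D_Y,\,S\in\mathcal D_S\}$. **Theorem (necessary conditions for optimality).** Let $(Y,S)\in\mathcal D_Y\times\mathcal D_S$ be a local minimum (in particular, possibly a global solution) of RCF with $D(Y,S)<\infty$. Then the following hold. (a) There are a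 subgradient $d=[d_{y_{vi}}D]$ of $D(\cdot,S)$ at $Y$ (in the sense of convex analysis, on all of $\mathbb R^{V\times\mathcal C}$) and constants $\alpha_{vi}$ such that, for all $v\in V$, $i\in\mathcal C$, $$d_{y_{vi}}D=\alpha_{vi}\ \text{ if } y_{vi}\in(0,1),\qquad d_{y_{vi}}D\ge\alpha_{vi}\ \text{ if } y_{vi}=0,\qquad d_{y_{vi}}D<\alpha_{vi}\ \text{ if } y_{vi}=1.$$ Moreover these can be chosen together with constants $\theta_v$, $v\in V$, such that $\alpha_{vi}=\theta_v$ whenever $y_{vi}<1$, and $d_{y_{vi}}D\le\theta_v$ whenever $y_{vi}=1$ and $v\notin\mathcal S_i$. (b) $D(Y,\cdot)$ is finite along small changes of each single coordinate of $S$, all partial derivatives $\partial D/\partial s_{vu}$, $(v,u)\in E$, exist at $(Y,S)$, and there are constants $\beta_v\ge0$, $v\in V$, and $\gamma_{e,r}\ge 0$, $e\in E$, $r\in\mathcal R$, such that, for every link $e=(v,u)\in E$ and every $r\in\mathcal R$, $$\frac{\partial D}{\partial s_{vu}}\ge-\beta_v+\gamma_{e,r}\ \text{ if } s_{vu}=0,$$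 and, for every link $(v,u)\in E$, $$\frac{\partial D}{\partial s_{vu}}=-\beta_v\ \text{ if } s_{vu}>0,\ \sum_{w\in O_v}s_{vw}=\hat s_v,\qquad \frac{\partial D}{\partial s_{vu}}=0\ \text{ if } s_{vu}>0,\ \sum_{w\in O_v}s_{vw}<\hat s_v .$$ Moreover they can be chosen as Karush–Kuhn–Tucker multipliers: $\partial D/\partial s_{vu}=-\beta_v+\gamma_{e,r}$ and $\gamma_{e,r}s_{vu}=0$ for all $e=(v,u)\in E$, $r\in\mathcal R$, and $\beta_v\bigl(\sum_{u\in O_v}s_{vu}-\hat s_v\bigr)=0$ for all $v\in V$. -/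

import Mathlib

open scoped NNReal ENNReal

noncomputable section

/-- A content request `(i, p)`: the requested item `i` and the path `p = (p₁, …, p_K)` of
`K = hops + 1` nodes along which it is forwarded. Indices are shifted by one:
`node 0` is the requesting node `p₁` and `node (Fin.last hops)` is the last node `p_K`. -/
structure Request (V C : Type*) where
  item : C
  hops : ℕ
  node : Fin (hops + 1) → V

/-- The two kinds of wired backhaul: behind a macro cell or behind a small cell. -/
inductive Backbone where
  | MC
  | SC

/-- A wireless caching network with node set `V` and catalog `C`. -/
structure CachingNetwork (V C : Type*) where
  /-- the directed transmission links; `(v, u)` is the link from `v` to `u` -/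
  E : Finset (V × V)
  ne_of_mem_E : ∀ v u, (v, u) ∈ E → v ≠ u
  /-- cache capacities `c_v` -/
  capacity : V → ℕ
  /-- designated sources `𝒮_i` -/
  sources : C → Set V
  /-- the finite set `ℛ` of requests -/
  requests : Finset (Request V C)
  /-- each requested path is simple, runs along links of the network, its response uses the
  reversed links, and it ends at a designated source of the item -/
  path_simple : ∀ r ∈ requests, Function.Injective r.node
  path_link : ∀ r ∈ requests, ∀ k : Fin r.hops, (r.node k.castSucc, r.node k.succ) ∈ E
  path_response : ∀ r ∈ requests, ∀ k : Fin r.hops, (r.node k.succ, r.node k.castSucc) ∈ E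
  path_source : ∀ r ∈ requests, r.node (Fin.last r.hops) ∈ sources r.item
  /-- arrival rates `λ_{(i,p)}` -/
  rate : Request V C → ℝ≥0
  rate_pos : ∀ r ∈ requests, 0 < rate r
  /-- distances `r_{vu}` between distinct nodes -/
  distance : V → V → ℝ
  distance_pos : ∀ v u, v ≠ u → 0 < distance v u
  /-- path loss exponent -/
  pathLoss : ℝ
  two_lt_pathLoss : 2 < pathLoss
  /-- residual self-interference gain `G_{uu}`, for which the path loss law `r ^ (-n)` has no
  meaning; it is `0` if a node cancels its own signal -/
  selfGain : V → ℝ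
  selfGain_nonneg : ∀ u, 0 ≤ selfGain u
  /-- receiver noise powers `N_u` -/
  noise : V → ℝ
  noise_pos : ∀ u, 0 < noise u
  /-- power budgets `ŝ_v` -/
  budget : V → ℝ
  /-- the nodes that are wired backhaul nodes, with their kind -/
  backbone : V → Option Backbone
  /-- the fixed wired backhaul delay `D_MC` or `D_SC` -/
  backhaulDelay : Backbone → ℝ≥0

namespace CachingNetwork

variable {V C : Type*} [Fintype V] [DecidableEq V] [Fintype C] (N : CachingNetwork V C)

/-- The transmit power `s_{vu}` (zero if `(v, u)` is not a link). -/
def power (S : N.E → ℝ) (v u : V) : ℝ :=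
  if h : (v, u) ∈ N.E then S ⟨(v, u), h⟩ else 0

/-- The total transmit power `∑_{u ∈ O_v} s_{vu}` of node `v`. -/
def totalPower (S : N.E → ℝ) (v : V) : ℝ :=
  ∑ u with (v, u) ∈ N.E, N.power S v u

/-- The channel power gain `G_{vu}`. -/
def gain (v u : V) : ℝ :=
  if v = u then N.selfGain u else N.distance v u ^ (-N.pathLoss)

/-- The signal-to-interference-plus-noise ratio of the link from `v` to `u`. -/
def SINR (S : N.E → ℝ) (v u : V) : ℝ :=
  N.gain v u * N.power S v u /
    (N.noise u + ∑ j ∈ Finset.univ.erase v, N.gain j u * ∑ w, N.power S j w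
      + N.gain v u * ∑ w ∈ Finset.univ.erase u, N.power S v w)

/-- The wireless delay `f(x) = 1 / log₂ (1 + x)`, which is `∞` at `x = 0`. -/
def wirelessDelay (x : ℝ) : ℝ≥0∞ := (ENNReal.ofReal (Real.logb 2 (1 + x)))⁻¹

/-- The delay on the response link `(p_{k+1}, p_k)`: a fixed wired delay if it is the last link
of the path and the last node is a backhaul node, and the wireless delay otherwise. -/
def hopDelay (S : N.E → ℝ) (r : Request V C) (k : Fin r.hops) : ℝ≥0∞ :=
  match N.backbone (r.node k.succ) with
  | some b => if k.succ = Fin.last r.hops then (N.backhaulDelay b : ℝ≥0∞)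
      else wirelessDelay (N.SINR S (r.node k.succ) (r.node k.castSucc))
  | none => wirelessDelay (N.SINR S (r.node k.succ) (r.node k.castSucc))

/-- `g_{p_k i}(Y) = 1 - min {1, ∑_{l ≤ k} y_{p_l i}}`, a nonnegative number. -/
def missFactor (Y : V → C → ℝ) (r : Request V C) (k : Fin r.hops) : ℝ :=
  1 - min 1 (∑ l with l ≤ k.castSucc, Y (r.node l) r.item)

/-- The relaxed delay cost `D(Y, S) ∈ [0, ∞]`, with the convention `∞ * 0 = 0`: a link that
is not needed costs nothing. -/
def cost (Y : V → C → ℝ) (S : N.E → ℝ) : ℝ≥0∞ :=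
  ∑ r ∈ N.requests, (N.rate r : ℝ≥0∞) *
    ∑ k : Fin r.hops, N.hopDelay S r k * ENNReal.ofReal (missFactor Y r k)

/-- The feasible set `𝒟_Y` of relaxed cache allocations. -/
def feasibleY : Set (V → C → ℝ) :=
  {Y | (∀ v, ∑ i, Y v i = N.capacity v) ∧ (∀ v i, Y v i ∈ Set.Icc (0 : ℝ) 1) ∧
    ∀ i, ∀ v ∈ N.sources i, Y v i = 1}

/-- The feasible set `𝒟_S` of power allocations. -/
def feasibleS : Set (N.E → ℝ) :=
  {S | (∀ v, N.totalPower S v ≤ N.budget v) ∧ ∀ e, 0 ≤ S e}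

/-- `d` is a (convex) subgradient at `Y` of the extended-real-valued function `D(·, S)` on the
whole space `ℝ^{V × C}`. -/
def IsSubgradientY (Y : V → C → ℝ) (S : N.E → ℝ) (d : V → C → ℝ) : Prop :=
  N.cost Y S ≠ ⊤ ∧ ∀ Z : V → C → ℝ, N.cost Z S ≠ ⊤ →
    (N.cost Y S).toReal + ∑ v, ∑ i, d v i * (Z v i - Y v i) ≤ (N.cost Z S).toReal

/-- `q` is the partial derivative `∂D/∂s_e` at `(Y, S)`. -/
def HasPartialDerivS (Y : V → C → ℝ) (S : N.E → ℝ) (e : N.E) (q : ℝ) : Prop :=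
  (∀ᶠ t in nhds (S e), N.cost Y (Function.update S e t) ≠ ⊤) ∧
    HasDerivAt (fun t : ℝ => (N.cost Y (Function.update S e t)).toReal) q (S e)

end CachingNetwork

end

/-! Freezing one block of variables turns the joint local minimum into a local minimum in each
block. With S fixed, the identity 1 - min{1, s} = max(1 - s, 0) makes D a sum of positive parts of
affine functions of Y with weights in [0, ∞], hence convex and polyhedral. With Y fixed, finiteness
of D forces every hop of infinite delay to have miss factor 0, so D is differentiable at S, even on
the boundary of 𝒟_S. Both feasible sets are polyhedra, so every direction compatible with the active
constraints is feasible, and Farkas' lemma yields multipliers without a constraint qualification.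
For Y, `farkas_posPart` handles the kinks and `exists_subgradient_of_isLocalMinOn` the infinite
weights, which act as further linear constraints. For S, `farkas` is applied to the gradient.
Evaluating the resulting identities on coordinate vectors gives the stated conditions. -/

open Filter Topology

/-! ### Farkas' lemma, with and without positive parts -/

/-- **Farkas' lemma** for finitely many linear functionals on a real vector space. -/
theorem farkas_finset {E ι : Type*} [AddCommGroup E] [Module ℝ E] [DecidableEq ι] (s : Finset ι) :
    ∀ (m : ι → E →ₗ[ℝ] ℝ) (g : E →ₗ[ℝ] ℝ), (∀ x, (∀ i ∈ s, 0 ≤ m i x) → 0 ≤ g x) →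
      ∃ μ : ι → ℝ, (∀ i, 0 ≤ μ i) ∧ g = ∑ i ∈ s, μ i • m i := by
  induction s using Finset.induction_on with
  | empty =>
    intro m g h
    refine ⟨0, fun _ => le_rfl, ?_⟩
    ext x
    have h1 := h x (by simp)
    have h2 := h (-x) (by simp)
    simp only [map_neg] at h2
    simpa using le_antisymm (by linarith) h1
  | insert a s ha ih =>
    intro m g h
    by_cases hg : ∀ x, (∀ i ∈ s, 0 ≤ m i x) → 0 ≤ g x
    · obtain ⟨μ, hμ, rfl⟩ := ih m g hg
      refine ⟨Function.update μ a 0, fun i => ?_, ?_⟩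
      · by_cases hi : i = a
        · simp [hi]
        · simpa [hi] using hμ i
      · rw [Finset.sum_insert ha]
        simp only [Function.update_self, zero_smul, zero_add]
        refine Finset.sum_congr rfl fun i hi => ?_
        rw [Function.update_of_ne (ne_of_mem_of_not_mem hi ha)]
    · push Not at hg
      obtain ⟨z, hz, hgz⟩ := hg
      have haz : m a z < 0 := by
        by_contra hcon
        refine absurd (h z fun i hi => ?_) (not_le.2 hgz)
        rcases Finset.mem_insert.1 hi with rfl | hi
        · exact not_lt.1 hcon
        · exact hz i hi
      obtain ⟨κ, hκ, hκz⟩ : ∃ κ : ℝ, 0 < κ ∧ κ * m a z = -1 :=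
        ⟨-(m a z)⁻¹, by simpa using haz, by simp [haz.ne]⟩
      -- The modified functionals are the old ones composed with x ↦ x + κ m_a(x) z, the projection
      -- onto ker m_a along z. On its range the constraint `a` holds trivially, so the induction
      -- hypothesis applies.
      obtain ⟨μ, hμ, hμg⟩ := ih (fun i => m i + (κ * m i z) • m a) (g + (κ * g z) • m a) (by
        intro x hx
        have := h (x + (κ * m a x) • z) (fun i hi => by
          rcases Finset.mem_insert.1 hi with rfl | hi
          · have : m i (x + (κ * m i x) • z) = m i x + m i x * (κ * m i z) := by
              simp only [map_add, map_smul, smul_eq_mul]; ring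
            rw [this, hκz]; simp
          · have := hx i hi
            simp only [LinearMap.add_apply, LinearMap.smul_apply, smul_eq_mul, map_add,
              map_smul] at this ⊢
            linarith)
        simp only [LinearMap.add_apply, LinearMap.smul_apply, smul_eq_mul, map_add,
          map_smul] at this ⊢
        linarith)
      -- The weight at `a` collects the multiples of `m a` introduced by the projection. It is
      -- nonnegative because m_i z ≥ 0 on `s` and g z < 0.
      refine ⟨Function.update μ a (∑ i ∈ s, μ i * (κ * m i z) - κ * g z), fun i => ?_, ?_⟩
      · by_cases hi : i = a
        · subst hi
          have h1 : 0 ≤ ∑ j ∈ s, μ j * (κ * m j z) :=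
            Finset.sum_nonneg fun j hj => mul_nonneg (hμ j) (mul_nonneg hκ.le (hz j hj))
          have h2 : κ * g z < 0 := mul_neg_of_pos_of_neg hκ hgz
          simp only [Function.update_self]
          linarith
        · simpa [hi] using hμ i
      · rw [Finset.sum_insert ha]
        have h1 : ∑ i ∈ s, Function.update μ a (∑ i ∈ s, μ i * (κ * m i z) - κ * g z) i • m i
            = ∑ i ∈ s, μ i • m i :=
          Finset.sum_congr rfl fun i hi => by
            rw [Function.update_of_ne (ne_of_mem_of_not_mem hi ha)]
        rw [h1, Function.update_self]
        ext x
        have h2 := LinearMap.congr_fun hμg x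
        simp only [LinearMap.add_apply, LinearMap.smul_apply, smul_eq_mul,
          LinearMap.sum_apply, mul_add, Finset.sum_add_distrib] at h2 ⊢
        have h3 : ∑ i ∈ s, μ i * (κ * m i z * m a x) = (∑ i ∈ s, μ i * (κ * m i z)) * m a x := by
          rw [Finset.sum_mul]
          exact Finset.sum_congr rfl fun i _ => by ring
        rw [h3] at h2
        linarith

theorem farkas {E ι : Type*} [AddCommGroup E] [Module ℝ E] [Fintype ι]
    (m : ι → E →ₗ[ℝ] ℝ) (g : E →ₗ[ℝ] ℝ) (h : ∀ x, (∀ i, 0 ≤ m i x) → 0 ≤ g x) :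
    ∃ μ : ι → ℝ, (∀ i, 0 ≤ μ i) ∧ ∀ x, g x = ∑ i, μ i * m i x := by
  classical
  obtain ⟨μ, hμ, hg⟩ := farkas_finset Finset.univ m g (fun x hx => h x fun i => hx i (by simp))
  exact ⟨μ, hμ, fun x => by simp [hg]⟩

/-- Farkas' lemma for the sum of a linear functional and positive parts of linear functionals. -/
theorem farkas_posPart {E ι J : Type*} [AddCommGroup E] [Module ℝ E] [Fintype ι] [Fintype J]
    (m : ι → E →ₗ[ℝ] ℝ) (c : E →ₗ[ℝ] ℝ) (l : J → E →ₗ[ℝ] ℝ) (w : J → ℝ)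
    (h : ∀ x, (∀ i, 0 ≤ m i x) → 0 ≤ c x + ∑ j, w j * max (l j x) 0) (hw : ∀ j, 0 ≤ w j) :
    ∃ (μ : ι → ℝ) (ρ : J → ℝ), (∀ i, 0 ≤ μ i) ∧ (∀ j, 0 ≤ ρ j ∧ ρ j ≤ w j) ∧
      ∀ x, c x + ∑ j, ρ j * l j x = ∑ i, μ i * m i x := by
  classical
  -- Epigraph trick: each max(l_j x, 0) is replaced by a new variable τ_j subject to τ_j ≥ 0 and τ_j
  -- ≥ l_j x. The multiplier of the latter is ρ_j.
  obtain ⟨μ, hμ, hg⟩ := farkas (E := E × (J → ℝ)) (ι := ι ⊕ J ⊕ J)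
    (Sum.elim (fun i => m i ∘ₗ LinearMap.fst ℝ E (J → ℝ))
      (Sum.elim (fun j => LinearMap.proj j ∘ₗ LinearMap.snd ℝ E (J → ℝ))
        (fun j => LinearMap.proj j ∘ₗ LinearMap.snd ℝ E (J → ℝ)
          - l j ∘ₗ LinearMap.fst ℝ E (J → ℝ))))
    (c ∘ₗ LinearMap.fst ℝ E (J → ℝ)
      + ∑ j, w j • (LinearMap.proj j ∘ₗ LinearMap.snd ℝ E (J → ℝ))) (by
    rintro ⟨x, τ⟩ hx
    have h1 : ∀ i, 0 ≤ m i x := fun i => by simpa using hx (Sum.inl i)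
    have h2 : ∀ j, 0 ≤ τ j := fun j => by simpa using hx (Sum.inr (Sum.inl j))
    have h3 : ∀ j, l j x ≤ τ j := fun j => by simpa using hx (Sum.inr (Sum.inr j))
    have h4 : ∑ j, w j * max (l j x) 0 ≤ ∑ j, w j * τ j :=
      Finset.sum_le_sum fun j _ => mul_le_mul_of_nonneg_left (max_le (h3 j) (h2 j)) (hw j)
    have h5 := h x h1
    simp only [LinearMap.add_apply, LinearMap.comp_apply, LinearMap.fst_apply,
      LinearMap.sum_apply, LinearMap.smul_apply, LinearMap.snd_apply, LinearMap.proj_apply,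
      smul_eq_mul]
    linarith)
  simp only [Fintype.sum_sum_type, Sum.elim_inl, Sum.elim_inr, LinearMap.add_apply,
    LinearMap.sub_apply, LinearMap.comp_apply, LinearMap.fst_apply,
    LinearMap.sum_apply, LinearMap.smul_apply, LinearMap.snd_apply, LinearMap.proj_apply,
    smul_eq_mul] at hg
  refine ⟨fun i => μ (Sum.inl i), fun j => μ (Sum.inr (Sum.inr j)), fun i => hμ _,
    fun j => ⟨hμ _, ?_⟩, fun x => ?_⟩
  -- The coefficient of τ_j shows that its two multipliers add up to w_j, whence ρ_j ≤ w_j.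
  · have h1 := hg (0, Pi.single j 1)
    simp [Pi.single_apply] at h1
    have h2 := hμ (Sum.inr (Sum.inl j))
    linarith
  · have h1 := hg (x, 0)
    simp at h1
    linarith

/-! ### First order conditions for polyhedral functions with values in [0, ∞] -/

/-- A nonnegative combination of positive parts of affine functions, with weights in `[0, ∞]`. -/
noncomputable def polyhedralSum {E J : Type*} [AddCommGroup E] [Module ℝ E] [Fintype J]
    (W : J → ENNReal) (b : J → ℝ) (l : J → E →ₗ[ℝ] ℝ) (x : E) : ENNReal :=
  ∑ j, W j * ENNReal.ofReal (b j + l j x)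

theorem polyhedralSum_ne_top {E J : Type*} [AddCommGroup E] [Module ℝ E] [Fintype J]
    {W : J → ENNReal} {b : J → ℝ} {l : J → E →ₗ[ℝ] ℝ} {x : E} :
    polyhedralSum W b l x ≠ ⊤ ↔ ∀ j, W j = ⊤ → b j + l j x ≤ 0 := by
  simp [polyhedralSum, ENNReal.sum_eq_top, ENNReal.mul_eq_top]

theorem toReal_polyhedralSum {E J : Type*} [AddCommGroup E] [Module ℝ E] [Fintype J]
    {W : J → ENNReal} {b : J → ℝ} {l : J → E →ₗ[ℝ] ℝ} {x : E}
    (hx : polyhedralSum W b l x ≠ ⊤) :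
    (polyhedralSum W b l x).toReal = ∑ j, (W j).toReal * max (b j + l j x) 0 := by
  rw [polyhedralSum, ENNReal.toReal_sum]
  · exact Finset.sum_congr rfl fun j _ => by
      rw [ENNReal.toReal_mul, ENNReal.toReal_ofReal']
  · exact fun j _ => (ENNReal.sum_ne_top.1 hx) j (Finset.mem_univ j)

/-- First order optimality for polyhedral functions with values in `[0, ∞]`: no constraint
qualification is needed. -/
theorem exists_subgradient_of_isLocalMinOn {E J ι : Type*} [AddCommGroup E] [Module ℝ E]
    [TopologicalSpace E] [ContinuousAdd E] [ContinuousSMul ℝ E] [Fintype J] [Fintype ι]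
    (W : J → ENNReal) (b : J → ℝ) (l : J → E →ₗ[ℝ] ℝ) (y : E) (K : Set E)
    (m : ι → E →ₗ[ℝ] ℝ)
    (hK : ∀ x, (∀ i, 0 ≤ m i x) → ∀ᶠ t : ℝ in 𝓝[>] 0, y + t • x ∈ K)
    (hy : polyhedralSum W b l y ≠ ⊤) (hmin : IsLocalMinOn (polyhedralSum W b l) K y) :
    ∃ μ : ι → ℝ, (∀ i, 0 ≤ μ i) ∧ ∀ z, polyhedralSum W b l z ≠ ⊤ →
      (polyhedralSum W b l y).toReal + ∑ i, μ i * m i (z - y)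
        ≤ (polyhedralSum W b l z).toReal := by
  classical
  set a : J → ℝ := fun j => b j + l j y with ha
  have hya : ∀ j, W j = ⊤ → a j ≤ 0 := polyhedralSum_ne_top.1 hy
  -- The functional is the directional derivative at `y`: terms with a_j > 0 are linear, those with
  -- a_j = 0 contribute a positive part, and those with a_j < 0 nothing. An infinite weight with a_j
  -- = 0 becomes the constraint l_j x ≤ 0; its weight in the sum is 0, since `toReal` sends ⊤ to 0.
  obtain ⟨μ, ρ, hμ, hρ, hsum⟩ := farkas_posPart (ι := ι ⊕ J)
    (Sum.elim m fun j => if W j = ⊤ ∧ a j = 0 then -l j else 0)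
    (∑ j, if 0 < a j then (W j).toReal • l j else 0) l
    (fun j => if a j = 0 then (W j).toReal else 0) (by
      intro x hx
      have hm : ∀ i, 0 ≤ m i x := fun i => hx (Sum.inl i)
      have hl : ∀ j, W j = ⊤ → a j = 0 → l j x ≤ 0 := fun j h1 h2 => by
        have := hx (Sum.inr j)
        simpa [h1, h2] using this
      have ht : Tendsto (fun t : ℝ => y + t • x) (𝓝[>] 0) (𝓝 y) := by
        have : Continuous fun t : ℝ => y + t • x := by fun_prop
        simpa using (this.tendsto 0).mono_left nhdsWithin_le_nhds
      have hev1 : ∀ᶠ t : ℝ in 𝓝[>] 0, polyhedralSum W b l y ≤ polyhedralSum W b l (y + t • x) :=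
        (tendsto_nhdsWithin_iff.2 ⟨ht, hK x hm⟩).eventually hmin
      -- For small t no nonzero a_j changes sign, so the increment of the function is exactly t
      -- times the directional derivative.
      have hev2 : ∀ j, ∀ᶠ t : ℝ in 𝓝[>] 0,
          (a j < 0 → a j + t * l j x < 0) ∧ (0 < a j → 0 < a j + t * l j x) := fun j => by
        have hc : Tendsto (fun t : ℝ => a j + t * l j x) (𝓝[>] 0) (𝓝 (a j)) := by
          have : Continuous fun t : ℝ => a j + t * l j x := by fun_prop
          simpa using (this.tendsto 0).mono_left nhdsWithin_le_nhds
        rcases lt_trichotomy (a j) 0 with h | h | h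
        · filter_upwards [hc.eventually_lt_const h] with t ht
          exact ⟨fun _ => ht, fun h' => absurd h' h.not_gt⟩
        · simp [h]
        · filter_upwards [hc.eventually_const_lt h] with t ht
          exact ⟨fun h' => absurd h' h.not_gt, fun _ => ht⟩
      obtain ⟨t, ⟨ht1, ht2⟩, ht0⟩ :=
        ((hev1.and (eventually_all.2 hev2)).and self_mem_nhdsWithin).exists
      have ht0 : 0 < t := ht0
      have happ : ∀ j, b j + l j (y + t • x) = a j + t * l j x := fun j => by
        simp only [map_add, map_smul, smul_eq_mul, ha]; ring
      have hfin : polyhedralSum W b l (y + t • x) ≠ ⊤ := by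
        refine polyhedralSum_ne_top.2 fun j hj => ?_
        rw [happ]
        rcases (hya j hj).lt_or_eq with h | h
        · exact ((ht2 j).1 h).le
        · rw [h, zero_add]
          exact mul_nonpos_of_nonneg_of_nonpos ht0.le (hl j hj h)
      have hle := ENNReal.toReal_mono hfin ht1
      rw [toReal_polyhedralSum hy, toReal_polyhedralSum hfin] at hle
      have hterm : ∀ j, (W j).toReal * max (b j + l j (y + t • x)) 0
          - (W j).toReal * max (b j + l j y) 0
          = t * ((if 0 < a j then (W j).toReal * l j x else 0)
            + (if a j = 0 then (W j).toReal else 0) * max (l j x) 0) := fun j => by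
        rw [happ]
        change _ - (W j).toReal * max (a j) 0 = _
        rcases lt_trichotomy (a j) 0 with h | h | h
        · rw [max_eq_right ((ht2 j).1 h).le, max_eq_right h.le]
          simp [h.ne, h.not_gt]
        · have : max (t * l j x) 0 = t * max (l j x) 0 := by
            rw [mul_max_of_nonneg _ _ ht0.le, mul_zero]
          simp only [h, zero_add, this, lt_irrefl, if_false, if_true, max_self]
          ring
        · rw [max_eq_left ((ht2 j).2 h).le, max_eq_left h.le]
          simp only [h, h.ne', if_true, if_false]
          ring
      rw [← sub_nonneg, ← Finset.sum_sub_distrib, Finset.sum_congr rfl fun j _ => hterm j,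
        ← Finset.mul_sum] at hle
      have hle := nonneg_of_mul_nonneg_right hle ht0
      rw [Finset.sum_add_distrib] at hle
      simp only [LinearMap.sum_apply]
      refine hle.trans_eq ?_
      congr 1
      refine Finset.sum_congr rfl fun j _ => ?_
      split_ifs <;> simp) (fun j => by
      split_ifs
      exacts [ENNReal.toReal_nonneg, le_rfl])
  refine ⟨fun i => μ (Sum.inl i), fun i => hμ _, fun z hz => ?_⟩
  have hza : ∀ j, W j = ⊤ → b j + l j z ≤ 0 := polyhedralSum_ne_top.1 hz
  have hs := hsum (z - y)
  simp only [Fintype.sum_sum_type, Sum.elim_inl, Sum.elim_inr, LinearMap.sum_apply] at hs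
  rw [toReal_polyhedralSum hy, toReal_polyhedralSum hz]
  -- The subgradient inequality holds term by term. For an infinite weight with a_j = 0, the extra
  -- multiplier contributes μ_j (b_j + l_j z), which is nonpositive wherever the function is finite.
  have hterm : ∀ j, (W j).toReal * max (a j) 0 +
      ((if 0 < a j then (W j).toReal • l j else 0 : E →ₗ[ℝ] ℝ) (z - y) + ρ j * l j (z - y)
        - μ (Sum.inr j) * (if W j = ⊤ ∧ a j = 0 then -l j else 0 : E →ₗ[ℝ] ℝ) (z - y))
      ≤ (W j).toReal * max (b j + l j z) 0 := fun j => by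
    have hd : l j (z - y) = b j + l j z - a j := by simp only [map_sub, ha]; ring
    have hw : 0 ≤ (W j).toReal := ENNReal.toReal_nonneg
    obtain ⟨h1, h2⟩ := hρ j
    rcases lt_trichotomy (a j) 0 with h | h | h
    · have h3 : ρ j = 0 := le_antisymm (by simpa [h.ne] using h2) h1
      simp only [h3, h.not_gt, h.ne, h.le, max_eq_right, if_false, and_false,
        LinearMap.zero_apply]
      simpa using mul_nonneg hw (le_max_right _ _)
    · by_cases hW : W j = ⊤
      · have h3 : ρ j = 0 := le_antisymm (by simpa [hW] using h2) h1
        have := mul_nonpos_of_nonneg_of_nonpos (hμ (Sum.inr j)) (hza j hW)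
        simp [h, hW, h3, -map_sub, hd]
        linarith
      · have h3 : ρ j ≤ (W j).toReal := by simpa [h] using h2
        have h4 : ρ j * (b j + l j z) ≤ (W j).toReal * max (b j + l j z) 0 :=
          (mul_le_mul_of_nonneg_left (le_max_left _ _) h1).trans
            (mul_le_mul_of_nonneg_right h3 (le_max_right _ _))
        simpa [h, hW, -map_sub, hd] using h4
    · have h3 : ρ j = 0 := le_antisymm (by simpa [h.ne'] using h2) h1
      have := mul_le_mul_of_nonneg_left (le_max_left (b j + l j z) 0) hw
      simp only [h3, h, h.ne', h.le, max_eq_left, if_true, if_false, and_false,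
        LinearMap.zero_apply, LinearMap.smul_apply, hd, smul_eq_mul]
      linarith
  have hadd := Finset.sum_le_sum fun j (_ : j ∈ Finset.univ) => hterm j
  rw [Finset.sum_add_distrib, Finset.sum_sub_distrib, Finset.sum_add_distrib] at hadd
  linarith

/-! ### The caching variables -/

theorem LinearMap.eq_sum_single_single {V C : Type*} [Fintype V] [Fintype C] [DecidableEq V]
    [DecidableEq C] (L : (V → C → ℝ) →ₗ[ℝ] ℝ) (h : V → C → ℝ) :
    L h = ∑ v, ∑ i, L (Pi.single v (Pi.single i 1)) * h v i := by
  have h1 : h = ∑ v, ∑ i, h v i • (Pi.single v (Pi.single i 1) : V → C → ℝ) := by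
    ext v i
    simp only [Finset.sum_apply, Pi.smul_apply, smul_eq_mul]
    rw [Finset.sum_eq_single v, Finset.sum_eq_single i] <;> simp +contextual [Pi.single_apply]
  conv_lhs => rw [h1]
  simp only [map_sum, map_smul, smul_eq_mul, mul_comm]

namespace CachingNetwork

variable {V C : Type*} (N : CachingNetwork V C)

/-- The entry `y_{vi}` as a linear functional of the cache allocation. -/
def entry (v : V) (i : C) : (V → C → ℝ) →ₗ[ℝ] ℝ :=
  LinearMap.proj i ∘ₗ LinearMap.proj v

@[simp]
theorem entry_apply (v : V) (i : C) (h : V → C → ℝ) : entry v i h = h v i := rfl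

theorem entry_single_single [DecidableEq V] [DecidableEq C] (p q : V × C) :
    entry p.1 p.2 (Pi.single q.1 (Pi.single q.2 1)) = if p = q then 1 else 0 := by
  rcases p with ⟨v, i⟩
  rcases q with ⟨u, j⟩
  by_cases hv : v = u
  · subst hv; simp [Pi.single_apply]
  · simp [hv]

/-- Because 1 - min{1, s} = max(1 - s, 0), and `ENNReal.ofReal` performs this truncation. The
weights may be infinite, as on a wireless hop with zero power. -/
theorem cost_eq_polyhedralSum [Fintype V] [DecidableEq V] (Y : V → C → ℝ) (S : N.E → ℝ) :
    N.cost Y S = polyhedralSum (J := Σ r : N.requests, Fin r.1.hops)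
      (fun j => (N.rate j.1.1 : ENNReal) * N.hopDelay S j.1.1 j.2) (fun _ => 1)
      (fun j => -∑ l with l ≤ j.2.castSucc, entry (j.1.1.node l) j.1.1.item) Y := by
  rw [polyhedralSum, Fintype.sum_sigma, cost, ← Finset.sum_coe_sort]
  refine Finset.sum_congr rfl fun r _ => ?_
  rw [Finset.mul_sum]
  refine Finset.sum_congr rfl fun k _ => ?_
  rw [mul_assoc]
  congr 2
  simp only [missFactor, LinearMap.neg_apply, LinearMap.sum_apply, entry_apply]
  set s := ∑ l with l ≤ k.castSucc, Y (r.1.node l) r.1.item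
  rcases le_total 1 s with h | h
  · rw [min_eq_left h, sub_self, ENNReal.ofReal_zero, ENNReal.ofReal_of_nonpos (by linarith)]
  · rw [min_eq_right h, sub_eq_add_neg]

/-- Inequalities that cut out the feasible directions of `𝒟_Y` at `Y`. -/
noncomputable def feasibleYConstraint [Fintype C] (Y : V → C → ℝ) :
    (V × C) ⊕ (V × C) ⊕ (V × C) ⊕ V ⊕ V → (V → C → ℝ) →ₗ[ℝ] ℝ :=
  open Classical in
  Sum.elim (fun p => if Y p.1 p.2 = 0 then entry p.1 p.2 else 0)
    (Sum.elim (fun p => if Y p.1 p.2 = 1 then -entry p.1 p.2 else 0)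
      (Sum.elim (fun p => if p.1 ∈ N.sources p.2 then entry p.1 p.2 else 0)
        (Sum.elim (fun v => ∑ i, entry v i) (fun v => -∑ i, entry v i))))

/-- Inactive bounds survive small steps by continuity, active ones by the sign conditions on `h`.
Each equality is encoded by two opposite inequalities; for a source entry, one of them is the active
bound y ≤ 1. -/
theorem eventually_mem_feasibleY [Fintype V] [Fintype C] {Y : V → C → ℝ} (hY : Y ∈ N.feasibleY) (h : V → C → ℝ)
    (hh : ∀ j, 0 ≤ N.feasibleYConstraint Y j h) :
    ∀ᶠ t : ℝ in 𝓝[>] 0, Y + t • h ∈ N.feasibleY := by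
  obtain ⟨hY1, hY2, hY3⟩ := hY
  have h0 : ∀ v i, Y v i = 0 → 0 ≤ h v i := fun v i e => by
    simpa [feasibleYConstraint, e] using hh (Sum.inl (v, i))
  have h1 : ∀ v i, Y v i = 1 → h v i ≤ 0 := fun v i e => by
    simpa [feasibleYConstraint, e] using hh (Sum.inr (Sum.inl (v, i)))
  have h2 : ∀ v i, v ∈ N.sources i → 0 ≤ h v i := fun v i e => by
    simpa [feasibleYConstraint, e] using hh (Sum.inr (Sum.inr (Sum.inl (v, i))))
  have h3 : ∀ v, 0 ≤ ∑ i, h v i := fun v => by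
    simpa [feasibleYConstraint] using hh (Sum.inr (Sum.inr (Sum.inr (Sum.inl v))))
  have h4 : ∀ v, ∑ i, h v i ≤ 0 := fun v => by
    simpa [feasibleYConstraint] using hh (Sum.inr (Sum.inr (Sum.inr (Sum.inr v))))
  have hev : ∀ v i, ∀ᶠ t : ℝ in 𝓝[>] 0, Y v i + t * h v i ∈ Set.Icc (0 : ℝ) 1 := by
    intro v i
    have hc : Tendsto (fun t : ℝ => Y v i + t * h v i) (𝓝[>] 0) (𝓝 (Y v i)) := by
      have : Continuous fun t : ℝ => Y v i + t * h v i := by fun_prop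
      simpa using (this.tendsto 0).mono_left nhdsWithin_le_nhds
    have hlow : ∀ᶠ t : ℝ in 𝓝[>] 0, 0 ≤ Y v i + t * h v i := by
      rcases (hY2 v i).1.eq_or_lt with e | e
      · filter_upwards [self_mem_nhdsWithin] with t ht
        rw [← e, zero_add]
        exact mul_nonneg (le_of_lt ht) (h0 v i e.symm)
      · exact hc.eventually_const_le e
    have hup : ∀ᶠ t : ℝ in 𝓝[>] 0, Y v i + t * h v i ≤ 1 := by
      rcases (hY2 v i).2.eq_or_lt with e | e
      · filter_upwards [self_mem_nhdsWithin] with t ht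
        rw [e]
        have := mul_nonpos_of_nonneg_of_nonpos (le_of_lt ht) (h1 v i e)
        linarith
      · exact hc.eventually_le_const e
    exact hlow.and hup
  filter_upwards [eventually_all.2 fun v => eventually_all.2 (hev v)] with t ht
  refine ⟨fun v => ?_, fun v i => by simpa using ht v i, fun i v hv => ?_⟩
  · simp only [Pi.add_apply, Pi.smul_apply, smul_eq_mul, Finset.sum_add_distrib,
      ← Finset.mul_sum, le_antisymm (h4 v) (h3 v), hY1 v, mul_zero, add_zero]
  · have := hY3 i v hv
    simp [this, le_antisymm (h1 v i this) (h2 v i hv)]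

theorem exists_caching_multipliers [Fintype V] [DecidableEq V] [Fintype C] {Y : V → C → ℝ} {S : N.E → ℝ} (hY : Y ∈ N.feasibleY)
    (hfin : N.cost Y S ≠ ⊤) (hmin : IsLocalMinOn (fun Z => N.cost Z S) N.feasibleY Y) :
    ∃ (d α : V → C → ℝ) (θ : V → ℝ),
      N.IsSubgradientY Y S d ∧
      (∀ v i, Y v i ∈ Set.Ioo (0 : ℝ) 1 → d v i = α v i) ∧
      (∀ v i, Y v i = 0 → α v i ≤ d v i) ∧
      (∀ v i, Y v i = 1 → d v i < α v i) ∧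
      (∀ v i, Y v i < 1 → α v i = θ v) ∧
      (∀ v i, Y v i = 1 → v ∉ N.sources i → d v i ≤ θ v) := by
  classical
  have hcost := fun Z => N.cost_eq_polyhedralSum Z S
  obtain ⟨μ, hμ, hsub⟩ := exists_subgradient_of_isLocalMinOn _ _ _ Y N.feasibleY
    (N.feasibleYConstraint Y) (N.eventually_mem_feasibleY hY) (by rwa [← hcost])
    (by simpa only [hcost] using hmin)
  simp only [← hcost] at hsub
  set L : (V → C → ℝ) →ₗ[ℝ] ℝ := ∑ j, μ j • N.feasibleYConstraint Y j with hL
  set d : V → C → ℝ := fun v i => L (Pi.single v (Pi.single i 1)) with hd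
  set θ : V → ℝ := fun v => μ (Sum.inr (Sum.inr (Sum.inr (Sum.inl v))))
    - μ (Sum.inr (Sum.inr (Sum.inr (Sum.inr v)))) with hθ
  -- The entries of the multiplier combination: one term for each bound active at (v, i), one for a
  -- source entry, and θ_v as the difference of the two multipliers of the row sum.
  have hds : ∀ v i, d v i = (if Y v i = 0 then μ (Sum.inl (v, i)) else 0)
      - (if Y v i = 1 then μ (Sum.inr (Sum.inl (v, i))) else 0)
      + (if v ∈ N.sources i then μ (Sum.inr (Sum.inr (Sum.inl (v, i)))) else 0) + θ v := by
    intro v i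
    have hblock : ∀ (ν : V × C → ℝ) (P : V × C → Prop),
        ∑ p, ν p * (if P p then entry p.1 p.2 else 0 : (V → C → ℝ) →ₗ[ℝ] ℝ)
          (Pi.single v (Pi.single i 1)) = if P (v, i) then ν (v, i) else 0 := by
      intro ν P
      rw [Finset.sum_eq_single (v, i)]
      · split_ifs <;> simp
      · intro p _ hp
        have := entry_single_single p (v, i)
        split_ifs <;> simp_all
      · simp
    have hrow : ∀ ν : V → ℝ, ∑ u, ν u * (∑ j, entry u j) (Pi.single v (Pi.single i (1 : ℝ)))
        = ν v := by
      intro ν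
      rw [Finset.sum_eq_single v] <;> simp +contextual
    have hb1 := hblock (fun p => μ (Sum.inl p)) (fun p => Y p.1 p.2 = 0)
    have hb2 := hblock (fun p => -μ (Sum.inr (Sum.inl p))) (fun p => Y p.1 p.2 = 1)
    have hb3 := hblock (fun p => μ (Sum.inr (Sum.inr (Sum.inl p)))) (fun p => p.1 ∈ N.sources p.2)
    have hr1 := hrow (fun u => μ (Sum.inr (Sum.inr (Sum.inr (Sum.inl u)))))
    have hr2 := hrow (fun u => -μ (Sum.inr (Sum.inr (Sum.inr (Sum.inr u)))))
    have hneg : ∀ p : V × C, μ (Sum.inr (Sum.inl p)) *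
        (if Y p.1 p.2 = 1 then -entry p.1 p.2 else 0 : (V → C → ℝ) →ₗ[ℝ] ℝ)
          (Pi.single v (Pi.single i 1)) = -μ (Sum.inr (Sum.inl p)) *
        (if Y p.1 p.2 = 1 then entry p.1 p.2 else 0 : (V → C → ℝ) →ₗ[ℝ] ℝ)
          (Pi.single v (Pi.single i 1)) := fun p => by split_ifs <;> simp
    have hrow_neg : ∀ u, μ (Sum.inr (Sum.inr (Sum.inr (Sum.inr u)))) *
        (-∑ j, entry u j) (Pi.single v (Pi.single i (1 : ℝ)))
        = -μ (Sum.inr (Sum.inr (Sum.inr (Sum.inr u)))) *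
          (∑ j, entry u j) (Pi.single v (Pi.single i (1 : ℝ))) := fun u => by
      rw [LinearMap.neg_apply, mul_neg, neg_mul]
    have hdv : d v i = ∑ j, μ j * N.feasibleYConstraint Y j (Pi.single v (Pi.single i 1)) := by
      simp [hd, hL]
    rw [hdv]
    simp only [Fintype.sum_sum_type, feasibleYConstraint, Sum.elim_inl, Sum.elim_inr, hneg,
      hrow_neg, hb1, hb2, hb3, hr1, hr2, hθ]
    split_ifs <;> ring
  have hsrc : ∀ v i, v ∈ N.sources i → Y v i = 1 := fun v i => hY.2.2 i v
  -- At entries equal to 1 the constant is unconstrained by the other conditions, so d + 1 secures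
  -- the strict inequality. The comparison with θ there is proved separately, away from sources.
  refine ⟨d, fun v i => if Y v i < 1 then θ v else d v i + 1, θ, ⟨hfin, fun Z hZ => ?_⟩,
    fun v i h => ?_, fun v i h => ?_, fun v i h => ?_, fun v i h => if_pos h, fun v i h hs => ?_⟩
  · have := hsub Z hZ
    have h1 : ∑ j, μ j * N.feasibleYConstraint Y j (Z - Y) = L (Z - Y) := by simp [hL]
    rw [h1, L.eq_sum_single_single] at this
    exact this
  · have hs : v ∉ N.sources i := fun h' => h.2.ne (hsrc v i h')
    simp only [if_pos h.2]
    rw [hds]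
    simp [hs, h.1.ne', h.2.ne]
  · have hs : v ∉ N.sources i := fun h' => zero_ne_one (h.symm.trans (hsrc v i h'))
    simp only [h, zero_lt_one, if_true]
    rw [hds]
    simpa [hs, h] using hμ _
  · simp [h]
  · rw [hds]
    simpa [hs, h] using hμ _

end CachingNetwork

/-! ### Differentiability of the cost in the powers -/

/-- An extended nonnegative function is finite around a point and its real part is differentiable
there. -/
def FiniteDifferentiableAt {E : Type*} [NormedAddCommGroup E] [NormedSpace ℝ E] (F : E → ENNReal)
    (x : E) : Prop :=
  (∀ᶠ z in 𝓝 x, F z ≠ ⊤) ∧ DifferentiableAt ℝ (fun z => (F z).toReal) x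

namespace FiniteDifferentiableAt

variable {E : Type*} [NormedAddCommGroup E] [NormedSpace ℝ E] {x : E}

theorem const {c : ENNReal} (hc : c ≠ ⊤) : FiniteDifferentiableAt (fun _ : E => c) x :=
  ⟨Eventually.of_forall fun _ => hc, differentiableAt_const _⟩

theorem mul_const {F : E → ENNReal} {c : ENNReal} (hF : FiniteDifferentiableAt F x)
    (hc : c ≠ ⊤) : FiniteDifferentiableAt (fun z => F z * c) x := by
  refine ⟨hF.1.mono fun z hz => ENNReal.mul_ne_top hz hc, ?_⟩
  simp only [ENNReal.toReal_mul]
  exact hF.2.mul_const _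

theorem const_mul {F : E → ENNReal} {c : ENNReal} (hF : FiniteDifferentiableAt F x)
    (hc : c ≠ ⊤) : FiniteDifferentiableAt (fun z => c * F z) x := by
  simpa only [mul_comm c] using hF.mul_const hc

theorem sum {ι : Type*} {s : Finset ι} {F : ι → E → ENNReal}
    (hF : ∀ i ∈ s, FiniteDifferentiableAt (F i) x) :
    FiniteDifferentiableAt (fun z => ∑ i ∈ s, F i z) x := by
  have hev : ∀ᶠ z in 𝓝 x, ∀ i ∈ s, F i z ≠ ⊤ :=
    (Finset.eventually_all s).2 fun i hi => (hF i hi).1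
  refine ⟨hev.mono fun z hz => ENNReal.sum_ne_top.2 hz, ?_⟩
  have hd : DifferentiableAt ℝ (fun z => ∑ i ∈ s, (F i z).toReal) x :=
    DifferentiableAt.fun_sum fun i hi => (hF i hi).2
  exact hd.congr_of_eventuallyEq (hev.mono fun z hz => ENNReal.toReal_sum hz)

end FiniteDifferentiableAt

namespace CachingNetwork

variable {V C : Type*} (N : CachingNetwork V C)

theorem finiteDifferentiableAt_wirelessDelay {E : Type*} [NormedAddCommGroup E] [NormedSpace ℝ E]
    {f : E → ℝ} {x : E} (hf : DifferentiableAt ℝ f x) (hx : 0 < f x) :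
    FiniteDifferentiableAt (fun z => wirelessDelay (f z)) x := by
  have hpos : ∀ᶠ z in 𝓝 x, 0 < Real.logb 2 (1 + f z) := by
    filter_upwards [hf.continuousAt.eventually_const_lt hx] with z hz
    exact Real.logb_pos one_lt_two (by linarith)
  refine ⟨hpos.mono fun z hz => by simpa [wirelessDelay] using hz, ?_⟩
  have hd : DifferentiableAt ℝ (fun z => (Real.logb 2 (1 + f z))⁻¹) x := by
    refine DifferentiableAt.fun_inv ?_ hpos.self_of_nhds.ne'
    simp only [Real.logb, div_eq_mul_inv]
    exact ((hf.const_add 1).log (by linarith)).mul_const _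
  refine hd.congr_of_eventuallyEq (hpos.mono fun z hz => ?_)
  simp [wirelessDelay, ENNReal.toReal_inv, ENNReal.toReal_ofReal hz.le]

theorem wirelessDelay_ne_top_iff {x : ℝ} (hx : 0 ≤ x) : wirelessDelay x ≠ ⊤ ↔ 0 < x := by
  rw [wirelessDelay, Ne, ENNReal.inv_eq_top, ENNReal.ofReal_eq_zero, not_le,
    Real.logb_pos_iff one_lt_two (by linarith)]
  constructor <;> intro <;> linarith

theorem gain_nonneg (v u : V) [DecidableEq V] : 0 ≤ N.gain v u := by
  rw [gain]
  split_ifs with h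
  · exact N.selfGain_nonneg u
  · exact Real.rpow_nonneg (N.distance_pos v u h).le _

theorem power_nonneg [DecidableEq V] {S : N.E → ℝ} (hS : ∀ e, 0 ≤ S e) (v u : V) :
    0 ≤ N.power S v u := by
  rw [power]
  split_ifs
  exacts [hS _, le_rfl]

theorem differentiable_power [DecidableEq V] (v u : V) :
    Differentiable ℝ fun S : N.E → ℝ => N.power S v u := by
  simp only [power]
  split_ifs with h
  · exact differentiable_apply _
  · exact differentiable_const _

variable [Fintype V] [DecidableEq V]

/-- Strict positivity of the noise keeps the denominator of the SINR away from 0, so the SINR is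
differentiable in the full sense even where some powers vanish. -/
theorem interference_pos {S : N.E → ℝ} (hS : ∀ e, 0 ≤ S e) (v u : V) :
    0 < N.noise u + ∑ j ∈ Finset.univ.erase v, N.gain j u * ∑ w, N.power S j w
      + N.gain v u * ∑ w ∈ Finset.univ.erase u, N.power S v w := by
  have h1 : 0 ≤ ∑ j ∈ Finset.univ.erase v, N.gain j u * ∑ w, N.power S j w :=
    Finset.sum_nonneg fun j _ => mul_nonneg (N.gain_nonneg j u)
      (Finset.sum_nonneg fun w _ => N.power_nonneg hS j w)
  have h2 : 0 ≤ N.gain v u * ∑ w ∈ Finset.univ.erase u, N.power S v w :=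
    mul_nonneg (N.gain_nonneg v u) (Finset.sum_nonneg fun w _ => N.power_nonneg hS v w)
  have h3 := N.noise_pos u
  linarith

theorem SINR_nonneg {S : N.E → ℝ} (hS : ∀ e, 0 ≤ S e) (v u : V) : 0 ≤ N.SINR S v u :=
  div_nonneg (mul_nonneg (N.gain_nonneg v u) (N.power_nonneg hS v u))
    (N.interference_pos hS v u).le

theorem differentiableAt_SINR {S : N.E → ℝ} (hS : ∀ e, 0 ≤ S e) (v u : V) :
    DifferentiableAt ℝ (fun S => N.SINR S v u) S := by
  have hp := fun v u => (N.differentiable_power v u).differentiableAt (x := S)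
  simp only [SINR, div_eq_mul_inv]
  refine ((hp v u).const_mul _).fun_mul (DifferentiableAt.fun_inv ?_ (N.interference_pos hS v u).ne')
  refine ((DifferentiableAt.fun_sum fun j _ => ?_).const_add _).add ?_
  · exact (DifferentiableAt.fun_sum fun w _ => hp j w).const_mul _
  · exact (DifferentiableAt.fun_sum fun w _ => hp v w).const_mul _

theorem finiteDifferentiableAt_hopDelay {S : N.E → ℝ} (hS : ∀ e, 0 ≤ S e) (r : Request V C)
    (k : Fin r.hops) (hk : N.hopDelay S r k ≠ ⊤) :
    FiniteDifferentiableAt (fun S => N.hopDelay S r k) S := by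
  have hw : wirelessDelay (N.SINR S (r.node k.succ) (r.node k.castSucc)) ≠ ⊤ →
      FiniteDifferentiableAt
        (fun S => wirelessDelay (N.SINR S (r.node k.succ) (r.node k.castSucc))) S := fun h =>
    finiteDifferentiableAt_wirelessDelay (N.differentiableAt_SINR hS _ _)
      ((wirelessDelay_ne_top_iff (N.SINR_nonneg hS _ _)).1 h)
  simp only [hopDelay] at hk ⊢
  split at hk
  · split_ifs at hk ⊢
    · exact .const hk
    · exact hw hk
  · exact hw hk

/-- A term with miss factor 0 vanishes for all powers, as that factor does not depend on them. Any
other term has finite delay at `S`, since rates are positive and the cost is finite; its delay is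
then a constant or a smooth function of a positive SINR. -/
theorem finiteDifferentiableAt_cost {Y : V → C → ℝ} {S : N.E → ℝ} (hS : ∀ e, 0 ≤ S e)
    (hfin : N.cost Y S ≠ ⊤) : FiniteDifferentiableAt (fun S => N.cost Y S) S := by
  refine FiniteDifferentiableAt.sum fun r hr => ?_
  refine FiniteDifferentiableAt.const_mul ?_ ENNReal.coe_ne_top
  refine FiniteDifferentiableAt.sum fun k hk => ?_
  by_cases hm : ENNReal.ofReal (missFactor Y r k) = 0
  · simp only [hm, mul_zero]
    exact .const ENNReal.zero_ne_top
  · refine (N.finiteDifferentiableAt_hopDelay hS r k fun htop => hfin ?_).mul_const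
      ENNReal.ofReal_ne_top
    refine ENNReal.sum_eq_top.2 ⟨r, hr, ?_⟩
    rw [ENNReal.sum_eq_top.2 ⟨k, hk, by rw [htop, ENNReal.top_mul hm]⟩]
    exact ENNReal.mul_top (by simpa using (N.rate_pos r hr).ne')

/-! ### The power variables -/

theorem totalPower_eq_sum (S : N.E → ℝ) (v : V) :
    N.totalPower S v = ∑ e : N.E, if e.1.1 = v then S e else 0 := by
  rw [totalPower, ← Finset.sum_filter]
  refine Finset.sum_bij' (fun u hu => ⟨(v, u), by simpa using hu⟩) (fun e _ => e.1.2) ?_ ?_ ?_ ?_ ?_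
  · simp
  · rintro ⟨⟨a, b⟩, he⟩ h
    simp only [Finset.mem_filter, Finset.mem_univ, true_and] at h ⊢
    subst h
    exact he
  · simp
  · rintro ⟨⟨a, b⟩, he⟩ h
    simp only [Finset.mem_filter, Finset.mem_univ, true_and] at h
    subst h
    rfl
  · intro u hu
    simp only [Finset.mem_filter, Finset.mem_univ, true_and] at hu
    simp [power, hu]

/-- Inequalities that cut out the feasible directions of `𝒟_S` at `S`. -/
noncomputable def feasibleSConstraint (S : N.E → ℝ) : N.E ⊕ V → (N.E → ℝ) →ₗ[ℝ] ℝ :=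
  Sum.elim (fun e => if S e = 0 then LinearMap.proj e else 0)
    (fun v => if N.totalPower S v = N.budget v then
      -∑ e : N.E, if e.1.1 = v then LinearMap.proj e else 0 else 0)

theorem feasibleSConstraint_inr {S : N.E → ℝ} {v : V} (hv : N.totalPower S v = N.budget v)
    (h : N.E → ℝ) : N.feasibleSConstraint S (Sum.inr v) h = -N.totalPower h v := by
  simp only [feasibleSConstraint, Sum.elim_inr, if_pos hv, LinearMap.neg_apply,
    LinearMap.sum_apply]
  rw [totalPower_eq_sum]
  congr 1
  refine Finset.sum_congr rfl fun e _ => ?_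
  split_ifs <;> simp

theorem eventually_mem_feasibleS {S : N.E → ℝ} (hS : S ∈ N.feasibleS) (h : N.E → ℝ)
    (hh : ∀ j, 0 ≤ N.feasibleSConstraint S j h) :
    ∀ᶠ t : ℝ in 𝓝[>] 0, S + t • h ∈ N.feasibleS := by
  obtain ⟨hS1, hS2⟩ := hS
  have htp : ∀ (t : ℝ) v, N.totalPower (S + t • h) v
      = N.totalPower S v + t * N.totalPower h v := fun t v => by
    simp only [totalPower_eq_sum, Finset.mul_sum, ← Finset.sum_add_distrib]
    refine Finset.sum_congr rfl fun e _ => ?_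
    split_ifs <;> simp
  have hlow : ∀ e, ∀ᶠ t : ℝ in 𝓝[>] 0, 0 ≤ S e + t * h e := fun e => by
    rcases (hS2 e).eq_or_lt with h0 | h0
    · have := hh (Sum.inl e)
      simp only [feasibleSConstraint, Sum.elim_inl, ← h0, if_true, LinearMap.proj_apply] at this
      filter_upwards [self_mem_nhdsWithin] with t ht
      rw [← h0, zero_add]
      exact mul_nonneg (le_of_lt ht) this
    · have hc : Continuous fun t : ℝ => S e + t * h e := by fun_prop
      refine Tendsto.eventually_const_le h0 ?_
      simpa using (hc.tendsto 0).mono_left nhdsWithin_le_nhds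
  have hup : ∀ v, ∀ᶠ t : ℝ in 𝓝[>] 0, N.totalPower S v + t * N.totalPower h v ≤ N.budget v :=
    fun v => by
    rcases (hS1 v).eq_or_lt with h0 | h0
    · have := hh (Sum.inr v)
      rw [N.feasibleSConstraint_inr h0] at this
      filter_upwards [self_mem_nhdsWithin] with t ht
      have := mul_nonneg (le_of_lt ht) this
      linarith
    · have hc : Continuous fun t : ℝ => N.totalPower S v + t * N.totalPower h v := by fun_prop
      refine Tendsto.eventually_le_const h0 ?_
      simpa using (hc.tendsto 0).mono_left nhdsWithin_le_nhds
  filter_upwards [eventually_all.2 hlow, eventually_all.2 hup] with t h1 h2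
  exact ⟨fun v => (htp t v).trans_le (h2 v), fun e => by simpa using h1 e⟩

theorem exists_power_multipliers {Y : V → C → ℝ} {S : N.E → ℝ} (hS : S ∈ N.feasibleS)
    (hfin : N.cost Y S ≠ ⊤) (hmin : IsLocalMinOn (fun T => N.cost Y T) N.feasibleS S) :
    ∃ (q : N.E → ℝ) (β : V → ℝ) (γ : N.E → ℝ),
      (∀ e, N.HasPartialDerivS Y S e (q e)) ∧ (∀ v, 0 ≤ β v) ∧ (∀ e, 0 ≤ γ e) ∧
      (∀ e, q e = -β e.1.1 + γ e) ∧
      (∀ v, β v * (N.totalPower S v - N.budget v) = 0) ∧ (∀ e, γ e * S e = 0) := by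
  obtain ⟨hev, hdiff⟩ := N.finiteDifferentiableAt_cost hS.2 hfin
  set L := fderiv ℝ (fun T => (N.cost Y T).toReal) S with hL
  have hmin' : IsLocalMinOn (fun T => (N.cost Y T).toReal) N.feasibleS S := by
    filter_upwards [hmin, mem_nhdsWithin_of_mem_nhds hev] with T h1 h2
    exact ENNReal.toReal_mono h2 h1
  -- Feasible directions lie in the positive tangent cone, where the derivative at a local minimum
  -- is nonnegative.
  obtain ⟨μ, hμ, hsum⟩ := farkas (N.feasibleSConstraint S) (L : (N.E → ℝ) →ₗ[ℝ] ℝ) fun h hh =>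
    hmin'.hasFDerivWithinAt_nonneg hdiff.hasFDerivAt.hasFDerivWithinAt
      (mem_posTangentConeAt_of_frequently_mem (N.eventually_mem_feasibleS hS h hh).frequently)
  -- Inactive constraints were encoded by the zero functional, so their multipliers may be reset to
  -- 0. This is complementary slackness.
  refine ⟨fun e => L (Pi.single e 1),
    fun v => if N.totalPower S v = N.budget v then μ (Sum.inr v) else 0,
    fun e => if S e = 0 then μ (Sum.inl e) else 0, fun e => ⟨?_, ?_⟩, fun v => ?_, fun e => ?_,
    fun e => ?_, fun v => ?_, fun e => ?_⟩
  · have hc : Continuous fun t : ℝ => Function.update S e t := by fun_prop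
    have := hc.tendsto (S e)
    rw [Function.update_eq_self] at this
    exact this.eventually hev
  · have h1 : HasFDerivAt (fun T => (N.cost Y T).toReal) L (Function.update S e (S e)) := by
      rw [Function.update_eq_self]
      exact hdiff.hasFDerivAt
    exact h1.comp_hasDerivAt (S e) (hasDerivAt_update S e (S e))
  · dsimp only
    split_ifs
    exacts [hμ _, le_rfl]
  · dsimp only
    split_ifs
    exacts [hμ _, le_rfl]
  · have h1 := hsum (Pi.single e 1)
    rw [Fintype.sum_sum_type, Finset.sum_eq_single e, Finset.sum_eq_single e.1.1] at h1
    · refine h1.trans ?_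
      rw [add_comm]
      congr 1
      · dsimp only
        split_ifs with h
        · rw [N.feasibleSConstraint_inr h, totalPower_eq_sum, Finset.sum_eq_single e] <;>
            simp +contextual
        · simp [feasibleSConstraint, h]
      · simp only [feasibleSConstraint, Sum.elim_inl]
        split_ifs <;> simp
    · intro v _ hv
      by_cases h : N.totalPower S v = N.budget v
      · rw [N.feasibleSConstraint_inr h, totalPower_eq_sum, Finset.sum_eq_zero, neg_zero, mul_zero]
        intro f _
        by_cases hf : f = e
        · simp [hf, hv.symm]
        · simp [hf]
      · simp [feasibleSConstraint, h]
    · simp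
    · intro f _ hf
      simp only [feasibleSConstraint, Sum.elim_inl]
      split_ifs <;> simp [hf]
    · simp
  · dsimp only
    split_ifs with h <;> simp [h]
  · dsimp only
    split_ifs with h <;> simp [h]

end CachingNetwork
-- Assembly of the two blocks
theorem mainTheorem5 {V C : Type*} [Fintype V] [DecidableEq V] [Fintype C]
    (N : CachingNetwork V C) (Y : V → C → ℝ) (S : N.E → ℝ)
    (hY : Y ∈ N.feasibleY) (hS : S ∈ N.feasibleS)
    (hfin : N.cost Y S ≠ ⊤)
    (hmin : IsLocalMinOn (fun x : (V → C → ℝ) × (N.E → ℝ) => N.cost x.1 x.2)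
      (N.feasibleY ×ˢ N.feasibleS) (Y, S)) :
    -- conditions on the caching variables
    (∃ (d α : V → C → ℝ) (θ : V → ℝ),
      N.IsSubgradientY Y S d ∧
      (∀ v i, Y v i ∈ Set.Ioo (0 : ℝ) 1 → d v i = α v i) ∧
      (∀ v i, Y v i = 0 → α v i ≤ d v i) ∧
      (∀ v i, Y v i = 1 → d v i < α v i) ∧
      -- apart from the entries equal to one, the constants depend on the node only
      (∀ v i, Y v i < 1 → α v i = θ v) ∧
      (∀ v i, Y v i = 1 → v ∉ N.sources i → d v i ≤ θ v)) ∧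
    -- conditions on the power variables
    (∃ (q : N.E → ℝ) (β : V → ℝ) (γ : N.E → Request V C → ℝ),
      (∀ e, N.HasPartialDerivS Y S e (q e)) ∧
      (∀ v, 0 ≤ β v) ∧
      (∀ e, ∀ r ∈ N.requests, 0 ≤ γ e r) ∧
      (∀ e, S e = 0 → ∀ r ∈ N.requests, -β e.1.1 + γ e r ≤ q e) ∧
      (∀ e, 0 < S e → N.totalPower S e.1.1 = N.budget e.1.1 → q e = -β e.1.1) ∧
      (∀ e, 0 < S e → N.totalPower S e.1.1 < N.budget e.1.1 → q e = 0) ∧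
      -- the constants are Karush-Kuhn-Tucker multipliers
      (∀ e, ∀ r ∈ N.requests, q e = -β e.1.1 + γ e r) ∧
      (∀ v, β v * (N.totalPower S v - N.budget v) = 0) ∧
      (∀ e, ∀ r ∈ N.requests, γ e r * S e = 0)) := by
  have hY' : IsLocalMinOn (fun Z => N.cost Z S) N.feasibleY Y :=
    (tendsto_nhdsWithin_iff.2 ⟨
      (by fun_prop : Continuous fun Z : V → C → ℝ => (Z, S)).continuousWithinAt,
      eventually_mem_nhdsWithin.mono fun Z hZ => Set.mk_mem_prod hZ hS⟩).eventually hmin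
  have hS' : IsLocalMinOn (fun T => N.cost Y T) N.feasibleS S :=
    (tendsto_nhdsWithin_iff.2 ⟨
      (by fun_prop : Continuous fun T : N.E → ℝ => (Y, T)).continuousWithinAt,
      eventually_mem_nhdsWithin.mono fun T hT => Set.mk_mem_prod hY hT⟩).eventually hmin
  refine ⟨N.exists_caching_multipliers hY hfin hY', ?_⟩
  obtain ⟨q, β, γ, hq, hβ, hγ, hqβ, hslack, hγS⟩ := N.exists_power_multipliers hS hfin hS'
  have hγ0 : ∀ e, 0 < S e → γ e = 0 := fun e he => (mul_eq_zero.1 (hγS e)).resolve_right he.ne'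
  -- One multiplier per link, that of s_e ≥ 0, serves for every request.
  refine ⟨q, β, fun e _ => γ e, hq, hβ, fun e _ _ => hγ e, fun e _ _ _ => (hqβ e).ge,
    fun e he _ => by rw [hqβ, hγ0 e he, add_zero], fun e he hlt => ?_, fun e _ _ => hqβ e, hslack,
    fun e _ _ => hγS e⟩
  rw [hqβ, hγ0 e he, (mul_eq_zero.1 (hslack _)).resolve_right (sub_neg.2 hlt).ne, neg_zero,
    add_zero]
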